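/- Let $\Omega,\widetilde\Omega\subset\mathbb R^n$ be domains (non-empty connected open sets), let $\varphi:\Omega\to\widetilde\Omega$ be a homeomorphism, and let $1\le p\le\infty$. For an open set $U\subset\mathbb R^n$, let $L^1_p(U)$ be the space of locally integrable, weakly differentiable functions $f:U\to\mathbb R$ with $\|f\mid L^1_p(U)\|:=\|\nabla f\mid L_p(U)\|<\infty$, where $\nabla f$ is the weak gradient. A mapping $\varphi=(\varphi_1,\dots,\varphi_n):U\to\mathbb R^n$ belongs to $L^1_p(U)$ if every coordinate function $\varphi_j$ does. For locally integrable $f$, the refined function is $$\tilde f(y)=\lim_{r\to0}\frac1{|B(y,r)|}\int_{B(y,r)}f(z)\,dz .$$ The composition operator $\varphi^*:L^1_\infty(\widetilde\Omega)\to L^1_p(\Omega)$ is called bounded if there is a constant $K<\infty$ such that for every $f\in L^1_\infty(\widetilde\Omega)$ the function $\varphi^*f:=\tilde f\circ\varphi$ is defined at every point of $\Omega$, belongs to $L^1_p(\Omega)$, and satisfies $$\|\varphi^*f\mid L^1_p(\Omega)\|\le K\,\|f\mid L^1_\infty(\widetilde\Omega)\| .$$ Theorem. The mapping $\varphi$ belongs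 to $L^1_p(\Omega)$ if and only if the composition operator $\varphi^*:L^1_\infty(\widetilde\Omega)\to L^1_p(\Omega)$ is bounded. -/

import Mathlib

open MeasureTheory Filter Topology Set
open scoped ENNReal NNReal ContDiff

namespace SobolevComposition

/-- `n`-dimensional Euclidean space. -/
abbrev Euc (n : ℕ) : Type := EuclideanSpace ℝ (Fin n)

/-- A domain of `ℝⁿ`: a nonempty connected open set. -/
structure IsDomainSet {n : ℕ} (U : Set (Euc n)) : Prop where
  isOpen : IsOpen U
  isConnected : IsConnected U

/-- `ψ` is a smooth real function with compact support contained in `U`. -/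
structure IsTest {n : ℕ} (U : Set (Euc n)) (ψ : Euc n → ℝ) : Prop where
  smooth : ContDiff ℝ ∞ ψ
  compact : HasCompactSupport ψ
  support : tsupport ψ ⊆ U

/-- `g` is a weak gradient of `f` on the open set `U`: it is locally integrable and
`∫_U f ∂ᵢψ = - ∫_U gᵢ ψ` for all test functions `ψ` and all coordinates `i`. -/
structure HasWeakGradient {n : ℕ} (U : Set (Euc n)) (f : Euc n → ℝ) (g : Euc n → Euc n) :
    Prop where
  locallyIntegrable : LocallyIntegrableOn g U volume
  integral_eq : ∀ ψ : Euc n → ℝ, IsTest U ψ → ∀ i : Fin n,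
    ∫ x in U, f x * fderiv ℝ ψ x (EuclideanSpace.single i 1) = - ∫ x in U, g x i * ψ x

/-- `f` is a locally integrable, weakly differentiable function on `U`. -/
def IsWeaklyDifferentiable {n : ℕ} (U : Set (Euc n)) (f : Euc n → ℝ) : Prop :=
  LocallyIntegrableOn f U volume ∧ ∃ g : Euc n → Euc n, HasWeakGradient U f g

open Classical in
/-- The weak gradient of `f` on `U` (unique up to null sets, see `HasWeakGradient.ae_eq`). -/
noncomputable def weakGradient {n : ℕ} (U : Set (Euc n)) (f : Euc n → ℝ) : Euc n → Euc n :=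
  if h : ∃ g : Euc n → Euc n, HasWeakGradient U f g then h.choose else 0

theorem hasWeakGradient_weakGradient {n : ℕ} {U : Set (Euc n)} {f : Euc n → ℝ}
    (h : ∃ g : Euc n → Euc n, HasWeakGradient U f g) :
    HasWeakGradient U f (weakGradient U f) := by
  rw [weakGradient, dif_pos h]
  exact h.choose_spec

/-- The seminorm `‖f | L¹_p(U)‖ = ‖∇f | L_p(U)‖`, for weakly differentiable `f`. -/
noncomputable def seminormL1 {n : ℕ} (p : ℝ≥0∞) (U : Set (Euc n)) (f : Euc n → ℝ) : ℝ≥0∞ :=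
  eLpNorm (weakGradient U f) p (volume.restrict U)

/-- `f` belongs to the homogeneous Sobolev space `L¹_p(U)`. -/
def MemL1 {n : ℕ} (p : ℝ≥0∞) (U : Set (Euc n)) (f : Euc n → ℝ) : Prop :=
  IsWeaklyDifferentiable U f ∧ seminormL1 p U f < (⊤ : ℝ≥0∞)

/-- A mapping belongs to `L¹_p(U)` if all its coordinate functions do. -/
def MapMemL1 {n : ℕ} (p : ℝ≥0∞) (U : Set (Euc n)) (φ : Euc n → Euc n) : Prop :=
  ∀ j : Fin n, MemL1 p U (fun x => φ x j)

/-- `a` is the limit of the averages of `f` over the balls `B(y, r)` as `r → 0`. -/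
def HasRefinedValue {n : ℕ} (f : Euc n → ℝ) (y : Euc n) (a : ℝ) : Prop :=
  Tendsto (fun r : ℝ => ⨍ z in Metric.ball y r, f z) (𝓝[>] (0 : ℝ)) (𝓝 a)

/-- The refined function (canonical representative)
`f̃(y) = lim_{r → 0} |B(y,r)|⁻¹ ∫_{B(y,r)} f`. -/
noncomputable def refined {n : ℕ} (f : Euc n → ℝ) (y : Euc n) : ℝ :=
  limUnder (𝓝[>] (0 : ℝ)) (fun r : ℝ => ⨍ z in Metric.ball y r, f z)

/-- The composition operator `φ^* f = f ∘ φ` is a bounded operator from `L¹_∞(V)` to `L¹_p(U)`,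
for `φ : U → V`. As composition is sensitive to null sets, elements of `L¹_∞(V)` are composed
through their refined representative; the exceptional sets for `L¹_∞` are empty, so the
composition has to be defined at every point of `U`. -/
def IsBoundedCompositionLInfty {n : ℕ} (p : ℝ≥0∞) (U V : Set (Euc n)) (φ : Euc n → Euc n) :
    Prop :=
  ∃ K : ℝ≥0, ∀ f : Euc n → ℝ, MemL1 (⊤ : ℝ≥0∞) V f →
    (∀ x ∈ U, ∃ a : ℝ, HasRefinedValue f (φ x) a) ∧
    MemL1 p U (refined f ∘ φ) ∧
    seminormL1 p U (refined f ∘ φ) ≤ K * seminormL1 (⊤ : ℝ≥0∞) V f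

/-- Weak gradients are unique up to null sets, so `seminormL1` does not depend on a choice. -/
theorem HasWeakGradient.ae_eq {n : ℕ} {U : Set (Euc n)} (hU : IsOpen U) {f : Euc n → ℝ}
    {g h : Euc n → Euc n} (hg : HasWeakGradient U f g) (hh : HasWeakGradient U f h) :
    g =ᵐ[volume.restrict U] h := by
  have coord : ∀ {k : Euc n → Euc n} (i : Fin n), LocallyIntegrableOn k U volume →
      LocallyIntegrableOn (fun x => k x i) U volume := by
    intro k i hk x hx
    obtain ⟨s, hs, hi⟩ := hk x hx
    exact ⟨s, hs, (EuclideanSpace.proj (𝕜 := ℝ) i).integrable_comp hi⟩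
  have key : ∀ i : Fin n, ∀ᵐ x ∂volume, x ∈ U → g x i - h x i = 0 := by
    intro i
    have hgi := coord i hg.locallyIntegrable
    have hhi := coord i hh.locallyIntegrable
    refine hU.ae_eq_zero_of_integral_contDiff_smul_eq_zero (hgi.sub hhi) ?_
    intro ψ hψ hc hs
    have e := (hg.integral_eq ψ ⟨hψ, hc, hs⟩ i).symm.trans (hh.integral_eq ψ ⟨hψ, hc, hs⟩ i)
    have hint : ∀ {k : Euc n → ℝ}, LocallyIntegrableOn k U volume →
        Integrable (fun x => k x * ψ x) volume := by
      intro k hk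
      have h1 : IntegrableOn (fun x => k x * ψ x) (tsupport ψ) volume :=
        (hk.integrableOn_compact_subset hs hc).mul_continuousOn
          hψ.continuous.continuousOn hc
      refine (integrableOn_iff_integrable_of_support_subset ?_).1 h1
      intro x hx
      exact subset_tsupport ψ (right_ne_zero_of_mul hx)
    have hrest : ∀ k : Euc n → ℝ, ∫ x in U, k x * ψ x = ∫ x, k x * ψ x := by
      intro k
      refine setIntegral_eq_integral_of_forall_compl_eq_zero ?_
      intro x hx
      have : ψ x = 0 := image_eq_zero_of_notMem_tsupport (fun hm => hx (hs hm))
      simp [this]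
    rw [hrest, hrest] at e
    have e2 : (fun x => ψ x • (g x i - h x i)) = fun x => g x i * ψ x - h x i * ψ x := by
      funext x
      simp only [smul_eq_mul]
      ring
    change ∫ x, ψ x • (g x i - h x i) = 0
    rw [e2, integral_sub (hint hgi) (hint hhi)]
    linarith
  rw [Filter.EventuallyEq, ae_restrict_iff' hU.measurableSet]
  filter_upwards [ae_all_iff.2 key] with x hx hxU
  ext i
  linarith [hx i hxU]

end SobolevComposition

/-!
The easy implication tests the operator on the coordinate functions `y ↦ y j`: they are continuous,
hence equal to their refined functions, and have bounded gradient, so that `φ_j` is the image of an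
element of `L¹_∞`.

For the other implication let `f` have a weak gradient bounded by `M`. Its mollifications are
locally uniformly Lipschitz and converge almost everywhere, so near each point `f` agrees almost
everywhere with a Lipschitz function; hence the refined function exists at every point and is a
continuous representative of `f` (`refined_of_bounded_weakGradient`).

It remains to differentiate `refined f ∘ φ`. For a smooth outer function `G` the chain rule
`∂ᵢ (G ∘ φ) = ∑ⱼ (∂ⱼ G ∘ φ) ∂ᵢ φⱼ` holds weakly (`integral_comp_mul_fderiv`); it is obtained by
mollifying `φ`, and the mollifier is transposed onto the continuous factor, so that pointwise
dominated convergence suffices. For `f` itself `∂ⱼ f ∘ φ` makes no sense, since `φ` may map a set of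
positive measure to a null set. Instead, the chain rule is applied to the mollifications `f_k`
of `f`. The coefficients `∂ⱼ f_k ∘ φ` are bounded by `M`, so they have weak-* limits `a j` in `L^∞`,
bounded by `M` (`exists_weak_limit`), while `f_k ∘ φ` converges pointwise. In the limit,
`∑ⱼ a j • ∇ φⱼ` is a weak gradient of `refined f ∘ φ` (`exists_hasWeakGradient_refined_comp`), and
its `L_p` norm is at most `M ∑ⱼ ‖∇ φⱼ‖_p`. The norm of the operator is thus at most
`∑ⱼ ‖φⱼ | L¹_p‖`.
-/

namespace SobolevComposition

open ContinuousLinearMap Metric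
open scoped Convolution

variable {n : ℕ}

/-! ### Mollification -/

/-- The mollification of `F` by the normalized bump function `ρ`. -/
noncomputable def mollify (ρ : ContDiffBump (0 : Euc n)) (F : Euc n → ℝ) : Euc n → ℝ :=
  ρ.normed volume ⋆[lsmul ℝ ℝ, volume] F

theorem mollify_apply (ρ : ContDiffBump (0 : Euc n)) (F : Euc n → ℝ) (x : Euc n) :
    mollify ρ F x = ∫ z, ρ.normed volume (x - z) * F z := by
  simp [mollify, convolution_eq_swap]

theorem contDiff_mollify (ρ : ContDiffBump (0 : Euc n)) {F : Euc n → ℝ}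
    (hF : LocallyIntegrable F volume) : ContDiff ℝ ∞ (mollify ρ F) :=
  ρ.hasCompactSupport_normed.contDiff_convolution_left _ ρ.contDiff_normed hF

theorem integral_normed_sub (ρ : ContDiffBump (0 : Euc n)) (x : Euc n) :
    ∫ z, ρ.normed volume (x - z) = 1 := by
  rw [integral_sub_left_eq_self (fun z => ρ.normed volume z) volume x, ρ.integral_normed]

theorem integrable_normed_sub (ρ : ContDiffBump (0 : Euc n)) (x : Euc n) :
    Integrable (fun z => ρ.normed volume (x - z)) := by
  have h : Integrable (fun z => ρ.normed volume z) (volume : Measure (Euc n)) :=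
    ρ.continuous_normed.integrable_of_hasCompactSupport ρ.hasCompactSupport_normed
  exact h.comp_sub_left x

theorem abs_mollify_le (ρ : ContDiffBump (0 : Euc n)) {F : Euc n → ℝ} {C : ℝ}
    (hF : ∀ z, |F z| ≤ C) (x : Euc n) : |mollify ρ F x| ≤ C := by
  rw [mollify_apply]
  have h := norm_integral_le_of_norm_le (f := fun z => ρ.normed volume (x - z) * F z)
    ((integrable_normed_sub ρ x).mul_const C) (Eventually.of_forall fun z => by
      rw [norm_mul, Real.norm_eq_abs, Real.norm_eq_abs, abs_of_nonneg (ρ.nonneg_normed _)]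
      exact mul_le_mul_of_nonneg_left (hF z) (ρ.nonneg_normed _))
  rwa [integral_mul_const, integral_normed_sub, one_mul] at h

theorem normed_sub_eq_zero (ρ : ContDiffBump (0 : Euc n)) {x z : Euc n}
    (h : z ∉ ball x ρ.rOut) : ρ.normed volume (x - z) = 0 := by
  have : x - z ∉ Function.support (ρ.normed volume) := by
    rw [ρ.support_normed_eq, mem_ball_zero_iff, ← dist_eq_norm, dist_comm]
    exact h
  simpa using this

theorem tsupport_normed_sub_subset (ρ : ContDiffBump (0 : Euc n)) (x : Euc n) :
    tsupport (fun z => ρ.normed volume (x - z)) ⊆ closedBall x ρ.rOut :=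
  closure_minimal (fun _ hz => ball_subset_closedBall
    (by_contra fun h => hz (normed_sub_eq_zero ρ h))) isClosed_closedBall

theorem isTest_normed_sub {U : Set (Euc n)} (ρ : ContDiffBump (0 : Euc n)) {x : Euc n}
    (hx : closedBall x ρ.rOut ⊆ U) : IsTest U (fun z => ρ.normed volume (x - z)) where
  smooth := ρ.contDiff_normed.comp (contDiff_const.sub contDiff_id)
  compact := (isCompact_closedBall x ρ.rOut).of_isClosed_subset (isClosed_tsupport _)
    (tsupport_normed_sub_subset ρ x)
  support := (tsupport_normed_sub_subset ρ x).trans hx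

/-- Mollification commutes with weak differentiation, away from the boundary of `U`: only the
values of `F` and `W` on the ball of radius `ρ.rOut` matter. -/
theorem fderiv_mollify_apply {U : Set (Euc n)} {f : Euc n → ℝ} {g : Euc n → Euc n}
    (hg : HasWeakGradient U f g) (ρ : ContDiffBump (0 : Euc n)) {x : Euc n}
    (hx : closedBall x ρ.rOut ⊆ U) {F W : Euc n → ℝ} (hF : LocallyIntegrable F volume)
    (hFf : ∀ᵐ z, z ∈ closedBall x ρ.rOut → F z = f z) (i : Fin n)
    (hW : ∀ᵐ z, z ∈ closedBall x ρ.rOut → W z = g z i) :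
    fderiv ℝ (mollify ρ F) x (EuclideanSpace.single i 1) = mollify ρ W x := by
  set v : Euc n := EuclideanSpace.single i 1
  set ψ : Euc n → ℝ := fun z => ρ.normed volume (x - z) with hψ
  have hT : IsTest U ψ := isTest_normed_sub ρ hx
  have hs : tsupport ψ ⊆ closedBall x ρ.rOut := tsupport_normed_sub_subset ρ x
  have hsm : ContDiff ℝ 1 (ρ.normed (volume : Measure (Euc n))) := ρ.contDiff_normed
  have hdψ : ∀ z, fderiv ℝ ψ z v = -(fderiv ℝ (ρ.normed volume) (x - z) v) := by
    intro z
    have h1 : HasFDerivAt (fun z : Euc n => x - z) (-ContinuousLinearMap.id ℝ (Euc n)) z := by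
      simpa using (hasFDerivAt_id z).const_sub x
    have h2 := ((hsm.differentiable one_ne_zero) (x - z)).hasFDerivAt.comp z h1
    have h3 : fderiv ℝ ψ z = _ := h2.fderiv
    rw [h3]
    simp
  have hd := ρ.hasCompactSupport_normed.hasFDerivAt_convolution_left (lsmul ℝ ℝ) hsm hF x
  have hex : ConvolutionExistsAt (fderiv ℝ (ρ.normed volume)) F x
      ((lsmul ℝ ℝ).precompL (Euc n)) volume :=
    (ρ.hasCompactSupport_normed.fderiv ℝ).convolutionExists_left _
      (hsm.continuous_fderiv one_ne_zero) hF x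
  have e1 : fderiv ℝ (mollify ρ F) x v = ∫ z, -(F z * fderiv ℝ ψ z v) := by
    have h3 : fderiv ℝ (mollify ρ F) x = _ := hd.fderiv
    rw [h3, convolution_eq_swap, ContinuousLinearMap.integral_apply hex.integrable_swap]
    refine integral_congr_ae (Eventually.of_forall fun z => ?_)
    simp only [hdψ, precompL_apply, lsmul_apply, smul_eq_mul]
    ring
  have e2 : ∫ z, -(F z * fderiv ℝ ψ z v) = ∫ z in U, -(f z * fderiv ℝ ψ z v) := by
    rw [setIntegral_eq_integral_of_forall_compl_eq_zero]
    · refine integral_congr_ae ?_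
      filter_upwards [hFf] with z hz
      by_cases hzb : z ∈ closedBall x ρ.rOut
      · rw [hz hzb]
      · have : fderiv ℝ ψ z = 0 :=
          image_eq_zero_of_notMem_tsupport fun h => hzb (hs (tsupport_fderiv_subset ℝ h))
        simp [this]
    · intro z hz
      have : fderiv ℝ ψ z = 0 :=
        image_eq_zero_of_notMem_tsupport fun h => hz (hT.support (tsupport_fderiv_subset ℝ h))
      simp [this]
  have e3 : ∫ z in U, g z i * ψ z = ∫ z, ψ z * W z := by
    rw [setIntegral_eq_integral_of_forall_compl_eq_zero]
    · refine integral_congr_ae ?_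
      filter_upwards [hW] with z hz
      by_cases hzb : z ∈ closedBall x ρ.rOut
      · rw [hz hzb, mul_comm]
      · have : ψ z = 0 := image_eq_zero_of_notMem_tsupport fun h => hzb (hs h)
        simp [this]
    · intro z hz
      have : ψ z = 0 := image_eq_zero_of_notMem_tsupport fun h => hz (hT.support h)
      simp [this]
  rw [e1, e2, integral_neg, hg.integral_eq ψ hT i, neg_neg, e3, mollify_apply]

/-- A sequence of bump functions shrinking to the origin. -/
noncomputable def shrinkingBump (n k : ℕ) : ContDiffBump (0 : Euc n) where
  rIn := 1 / (2 * ((k : ℝ) + 1))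
  rOut := 1 / ((k : ℝ) + 1)
  rIn_pos := by positivity
  rIn_lt_rOut := by
    apply one_div_lt_one_div_of_lt <;> linarith [(k.cast_nonneg : (0 : ℝ) ≤ k)]

theorem tendsto_rOut_shrinkingBump :
    Tendsto (fun k => (shrinkingBump n k).rOut) atTop (𝓝 0) :=
  tendsto_one_div_add_atTop_nhds_zero_nat

theorem eventually_rOut_shrinkingBump_lt {δ : ℝ} (hδ : 0 < δ) :
    ∀ᶠ k in atTop, (shrinkingBump n k).rOut < δ :=
  tendsto_rOut_shrinkingBump.eventually_lt_const hδ

theorem ae_tendsto_mollify {F : Euc n → ℝ} (hF : LocallyIntegrable F volume) :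
    ∀ᵐ x, Tendsto (fun k => mollify (shrinkingBump n k) F x) atTop (𝓝 (F x)) := by
  refine ContDiffBump.ae_convolution_tendsto_right_of_locallyIntegrable (K := 2)
    tendsto_rOut_shrinkingBump (Eventually.of_forall fun k => le_of_eq ?_) hF
  have : (k : ℝ) + 1 ≠ 0 := by positivity
  simp only [shrinkingBump]
  field_simp

/-- Mollifications with a varying kernel, function and point converge as soon as the functions
converge jointly. -/
theorem tendsto_mollify {ι : Type*} {l : Filter ι} {k : ι → ℕ} {F : ι → Euc n → ℝ}
    {y : ι → Euc n} {x : Euc n} {a : ℝ} (hk : Tendsto k l atTop)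
    (hm : ∀ᶠ i in l, AEStronglyMeasurable (F i) volume)
    (hF : Tendsto (Function.uncurry F) (l ×ˢ 𝓝 x) (𝓝 a)) (hy : Tendsto y l (𝓝 x)) :
    Tendsto (fun i => mollify (shrinkingBump n (k i)) (F i) (y i)) l (𝓝 a) :=
  ContDiffBump.convolution_tendsto_right (tendsto_rOut_shrinkingBump.comp hk) hm hF hy

/-! ### The refined function of a function with bounded weak gradient -/

theorem locallyIntegrableOn_coord {U : Set (Euc n)} {g : Euc n → Euc n}
    (hg : LocallyIntegrableOn g U volume) (i : Fin n) :
    LocallyIntegrableOn (fun z => g z i) U volume := by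
  intro x hx
  obtain ⟨s, hs, hi⟩ := hg x hx
  exact ⟨s, hs, (EuclideanSpace.proj (𝕜 := ℝ) i).integrable_comp hi⟩

theorem abs_coord_le_norm (x : Euc n) (i : Fin n) : |x i| ≤ ‖x‖ := by
  simpa using PiLp.norm_apply_le x i

theorem apply_eq_sum_single (L : Euc n →L[ℝ] ℝ) (x : Euc n) :
    L x = ∑ i, x i * L (EuclideanSpace.single i 1) := by
  conv_lhs => rw [← (EuclideanSpace.basisFun (Fin n) ℝ).sum_repr x]
  simp

theorem opNorm_le_of_single (L : Euc n →L[ℝ] ℝ) {M : ℝ} (hM : 0 ≤ M)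
    (h : ∀ i, |L (EuclideanSpace.single i 1)| ≤ M) : ‖L‖ ≤ n * M := by
  refine L.opNorm_le_bound (by positivity) fun x => ?_
  rw [apply_eq_sum_single]
  calc ‖∑ i, x i * L (EuclideanSpace.single i 1)‖
      ≤ ∑ i : Fin n, ‖x‖ * M := by
        refine norm_sum_le_of_le _ fun i _ => ?_
        rw [norm_mul]
        exact mul_le_mul (abs_coord_le_norm x i) (h i) (norm_nonneg _) (norm_nonneg _)
    _ = n * M * ‖x‖ := by simp; ring

/-- A coordinate of an essentially bounded weak gradient has an everywhere bounded
representative defined on the whole space. -/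
theorem exists_bounded_coord {V : Set (Euc n)} (hV : IsOpen V) {g : Euc n → Euc n}
    (hg : LocallyIntegrableOn g V volume) {M : ℝ≥0}
    (hM : ∀ᵐ z, z ∈ V → ‖g z‖ ≤ M) (i : Fin n) :
    ∃ W : Euc n → ℝ, LocallyIntegrable W volume ∧ (∀ z, |W z| ≤ M) ∧
      ∀ᵐ z, z ∈ V → W z = g z i := by
  set W₀ : Euc n → ℝ := V.indicator fun z => g z i
  have hW₀ : AEStronglyMeasurable W₀ volume :=
    (aestronglyMeasurable_indicator_iff hV.measurableSet).2
      (locallyIntegrableOn_coord hg i).aestronglyMeasurable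
  have hb : ∀ z, |max (-(M : ℝ)) (min M (W₀ z))| ≤ M := fun z =>
    abs_le.2 ⟨le_max_left _ _, max_le (by linarith [M.2]) (min_le_left _ _)⟩
  refine ⟨fun z => max (-(M : ℝ)) (min M (W₀ z)), ?_, hb, ?_⟩
  · refine (locallyIntegrable_const (M : ℝ)).mono
      (Continuous.comp_aestronglyMeasurable (g := fun t : ℝ => max (-(M : ℝ)) (min M t))
        (by fun_prop) hW₀) (Eventually.of_forall fun z => ?_)
    simpa using hb z
  · filter_upwards [hM] with z hz hzV
    have h := abs_le.1 ((abs_coord_le_norm (g z) i).trans (hz hzV))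
    simp only [W₀, indicator_of_mem hzV]
    rw [min_eq_right h.2, max_eq_right h.1]

/-- A function with bounded weak gradient agrees almost everywhere near each point with a
continuous (in fact Lipschitz) function: its mollifications are uniformly Lipschitz and converge to
it almost everywhere. -/
theorem exists_continuous_ae_eq_ball {V : Set (Euc n)} (hV : IsOpen V) {f : Euc n → ℝ}
    {g : Euc n → Euc n} (hf : LocallyIntegrableOn f V volume) (hg : HasWeakGradient V f g)
    {M : ℝ≥0} (hM : ∀ᵐ z, z ∈ V → ‖g z‖ ≤ M) {y : Euc n} (hy : y ∈ V) :
    ∃ R > 0, ball y R ⊆ V ∧ ∃ h : Euc n → ℝ, Continuous h ∧ ∀ᵐ z, z ∈ ball y R → f z = h z := by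
  obtain ⟨r, hr, hrV⟩ := nhds_basis_closedBall.mem_iff.1 (hV.mem_nhds hy)
  have hR : 0 < r / 2 := half_pos hr
  have hball : ball y (r / 2) ⊆ closedBall y r :=
    (ball_subset_ball (by linarith)).trans ball_subset_closedBall
  refine ⟨r / 2, hR, hball.trans hrV, ?_⟩
  set F : Euc n → ℝ := (closedBall y r).indicator f
  have hF : LocallyIntegrable F volume := by
    refine Integrable.locallyIntegrable ?_
    exact (hf.integrableOn_compact_subset hrV (isCompact_closedBall y r)).integrable_indicator
      measurableSet_closedBall
  choose W _ hWM hWg using exists_bounded_coord hV hg.locallyIntegrable hM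
  set C : ℝ≥0 := n * M
  have hlip : ∀ᶠ k in atTop,
      LipschitzOnWith C (mollify (shrinkingBump n k) F) (ball y (r / 2)) := by
    filter_upwards [eventually_rOut_shrinkingBump_lt (n := n) hR] with k hk
    refine (convex_ball _ _).lipschitzOnWith_of_nnnorm_fderiv_le (𝕜 := ℝ)
      (fun x _ => (contDiff_mollify _ hF).differentiable (by simp) x) fun x hx => ?_
    have hsub : closedBall x (shrinkingBump n k).rOut ⊆ closedBall y r := by
      refine closedBall_subset_closedBall' ?_
      linarith [mem_ball.1 hx]
    have : ‖fderiv ℝ (mollify (shrinkingBump n k) F) x‖ ≤ n * M := by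
      refine opNorm_le_of_single _ M.2 fun i => ?_
      rw [fderiv_mollify_apply hg (shrinkingBump n k) (hsub.trans hrV) hF
        (Eventually.of_forall fun z hz => indicator_of_mem (hsub hz) f) i
        (by filter_upwards [hWg i] with z hz hzb using hz (hrV (hsub hzb)))]
      exact abs_mollify_le _ (hWM i) x
    exact_mod_cast this
  -- The uniform Lipschitz bound survives on the set, of full measure, where the mollifications
  -- converge; from there the function is extended to the whole space.
  set S : Set (Euc n) := {x ∈ ball y (r / 2) |
    Tendsto (fun k => mollify (shrinkingBump n k) F x) atTop (𝓝 (F x))}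
  have hS : LipschitzOnWith C F S := by
    refine LipschitzOnWith.of_dist_le_mul fun a ha b hb => ?_
    refine le_of_tendsto (ha.2.dist hb.2) ?_
    filter_upwards [hlip] with k hk using hk.dist_le_mul a ha.1 b hb.1
  obtain ⟨h, hh, heq⟩ := hS.extend_real
  refine ⟨h, hh.continuous, ?_⟩
  filter_upwards [ae_tendsto_mollify hF] with z hz hzb
  rw [← heq ⟨hzb, hz⟩]
  exact (indicator_of_mem (hball hzb) f).symm

/-- If `f` agrees almost everywhere near `y` with a continuous function, its refined value at `y` is
the value of that function. -/
theorem hasRefinedValue_of_ae_eq {f h : Euc n → ℝ} (hh : Continuous h) {y : Euc n} {R : ℝ}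
    (hR : 0 < R) (hfh : ∀ᵐ z, z ∈ ball y R → f z = h z) : HasRefinedValue f y (h y) := by
  refine Metric.tendsto_nhds.2 fun ε hε => ?_
  obtain ⟨δ, hδ, hhδ⟩ := Metric.continuousAt_iff.1 (hh.continuousAt (x := y)) (ε / 2) (half_pos hε)
  have hpos : (0 : ℝ) < min δ R := lt_min hδ hR
  filter_upwards [Ioo_mem_nhdsGT hpos] with r hr
  have hae : ∀ᵐ z ∂volume.restrict (ball y r), f z = h z := by
    rw [ae_restrict_iff' measurableSet_ball]
    filter_upwards [hfh] with z hz hzr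
    exact hz (ball_subset_ball (hr.2.le.trans (min_le_right _ _)) hzr)
  have hint : IntegrableOn f (ball y r) volume := by
    refine IntegrableOn.congr_fun_ae ?_ (hae.mono fun _ h => h.symm)
    exact ((hh.continuousOn.integrableOn_compact (isCompact_closedBall y r)).mono_set
      ball_subset_closedBall)
  have hmem := (convex_closedBall (h y) (ε / 2)).set_average_mem isClosed_closedBall
    (measure_ball_pos volume y hr.1).ne' measure_ball_lt_top.ne (f := f) (t := ball y r) (by
      filter_upwards [hae, ae_restrict_mem measurableSet_ball] with z hz hzr
      rw [hz]
      exact (hhδ (lt_of_lt_of_le (mem_ball.1 hzr) (hr.2.le.trans (min_le_left _ _)))).le) hint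
  exact lt_of_le_of_lt (mem_closedBall.1 hmem) (half_lt_self hε)

theorem HasRefinedValue.refined_eq {f : Euc n → ℝ} {y : Euc n} {a : ℝ}
    (h : HasRefinedValue f y a) : refined f y = a :=
  h.limUnder_eq

theorem refined_eq_self {f : Euc n → ℝ} (hf : Continuous f) : refined f = f :=
  funext fun _ => (hasRefinedValue_of_ae_eq hf one_pos
    (Eventually.of_forall fun _ _ => rfl)).refined_eq

/-- A function with bounded weak gradient has a refined value at every point, and the refined
function is a continuous representative of it. -/
theorem refined_of_bounded_weakGradient {V : Set (Euc n)} (hV : IsOpen V) {f : Euc n → ℝ}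
    {g : Euc n → Euc n} (hf : LocallyIntegrableOn f V volume) (hg : HasWeakGradient V f g)
    {M : ℝ≥0} (hM : ∀ᵐ z, z ∈ V → ‖g z‖ ≤ M) :
    (∀ y ∈ V, HasRefinedValue f y (refined f y)) ∧ ContinuousOn (refined f) V ∧
      ∀ᵐ z, z ∈ V → refined f z = f z := by
  have key : ∀ y ∈ V, ∃ R > 0, ∃ h : Euc n → ℝ, Continuous h ∧
      (∀ z ∈ ball y R, HasRefinedValue f z (h z)) ∧ ∀ᵐ z, z ∈ ball y R → f z = h z := by
    intro y hy
    obtain ⟨R, hR, -, h, hh, hae⟩ := exists_continuous_ae_eq_ball hV hf hg hM hy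
    refine ⟨R, hR, h, hh, fun z hz => ?_, hae⟩
    obtain ⟨ε, hε, hεR⟩ := Metric.isOpen_iff.1 isOpen_ball z hz
    exact hasRefinedValue_of_ae_eq hh hε (hae.mono fun w hw hwε => hw (hεR hwε))
  refine ⟨fun y hy => ?_, fun y hy => ?_, ?_⟩
  · obtain ⟨R, hR, h, -, hv, -⟩ := key y hy
    have := hv y (mem_ball_self hR)
    rwa [this.refined_eq]
  · obtain ⟨R, hR, h, hh, hv, -⟩ := key y hy
    refine (hh.continuousAt.congr ?_).continuousWithinAt
    filter_upwards [ball_mem_nhds y hR] with z hz using (hv z hz).refined_eq.symm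
  · change volume {z | ¬ (z ∈ V → refined f z = f z)} = 0
    refine measure_null_of_locally_null _ fun y hy => ?_
    have hyV : y ∈ V := by
      by_contra hc
      exact hy fun h => absurd h hc
    obtain ⟨R, hR, h, hh, hv, hae⟩ := key y hyV
    refine ⟨{z | ¬ (z ∈ V → refined f z = f z)} ∩ ball y R,
      inter_mem self_mem_nhdsWithin (mem_nhdsWithin_of_mem_nhds (ball_mem_nhds y hR)),
      measure_mono_null ?_ hae⟩
    rintro z ⟨hz, hzR⟩ hc
    exact hz fun _ => (hv z hzR).refined_eq.trans (hc hzR).symm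

/-! ### Weak limits of bounded sequences of functions -/

/-- On a finite measure space, a bounded sequence of functions converges weakly in `L²` along an
ultrafilter: the closed balls of the dual of `L²` are weak-* compact. -/
theorem exists_weak_limit_L2 {α : Type*} [MeasurableSpace α] {μ : Measure α} [IsFiniteMeasure μ]
    {b : ℕ → α → ℝ} {M : ℝ} (hb : ∀ k, AEStronglyMeasurable (b k) μ) (hM : ∀ k x, |b k x| ≤ M) :
    ∃ c : α → ℝ, MemLp c 2 μ ∧ ∀ v : α → ℝ, MemLp v 2 μ →
      Tendsto (fun k => ∫ x, b k x * v x ∂μ) (hyperfilter ℕ : Filter ℕ) (𝓝 (∫ x, c x * v x ∂μ)) := by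
  have hbp : ∀ k, MemLp (b k) 2 μ := fun k =>
    MemLp.of_bound (hb k) M (Eventually.of_forall fun x => hM k x)
  set B : ℕ → Lp ℝ 2 μ := fun k => (hbp k).toLp (b k)
  have hin : ∀ {u v : α → ℝ} (hu : MemLp u 2 μ) (hv : MemLp v 2 μ),
      inner ℝ (hu.toLp u) (hv.toLp v) = ∫ x, u x * v x ∂μ := by
    intro u v hu hv
    rw [L2.inner_def]
    refine integral_congr_ae ?_
    filter_upwards [hu.coeFn_toLp, hv.coeFn_toLp] with x h1 h2
    rw [h1, h2, real_inner_eq_re_inner]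
    simp [mul_comm]
  obtain ⟨C, hC⟩ : ∃ C, ∀ k, ‖B k‖ ≤ C :=
    ⟨_, fun k => Lp.norm_le_of_ae_bound (C := |M|) (by positivity) (by
      filter_upwards [(hbp k).coeFn_toLp] with x hx
      rw [hx]
      exact (hM k x).trans (le_abs_self M))⟩
  set T : ℕ → WeakDual ℝ (Lp ℝ 2 μ) := fun k =>
    StrongDual.toWeakDual (InnerProductSpace.toDual ℝ (Lp ℝ 2 μ) (B k))
  obtain ⟨ℓ, -, hℓ⟩ := (WeakDual.isCompact_closedBall (𝕜 := ℝ) (E := Lp ℝ 2 μ) 0 C).ultrafilter_le_nhds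
    ((hyperfilter ℕ).map T) (by
      rw [le_principal_iff]
      refine Filter.mem_map.2 (univ_mem' fun k => ?_)
      simp only [mem_preimage, mem_closedBall_zero_iff, T]
      simpa using hC k)
  set c : Lp ℝ 2 μ := (InnerProductSpace.toDual ℝ (Lp ℝ 2 μ)).symm (WeakDual.toStrongDual ℓ)
  refine ⟨c, Lp.memLp c, fun v hv => ?_⟩
  have h1 : Tendsto (fun k => T k (hv.toLp v)) (hyperfilter ℕ : Filter ℕ) (𝓝 (ℓ (hv.toLp v))) :=
    ((WeakDual.eval_continuous (hv.toLp v)).tendsto ℓ).comp hℓ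
  have h2 : ℓ (hv.toLp v) = ∫ x, c x * v x ∂μ := by
    rw [← hin (Lp.memLp c) hv, Lp.toLp_coeFn]
    exact (InnerProductSpace.toDual_symm_apply (𝕜 := ℝ)).symm
  rw [← h2]
  refine h1.congr fun k => ?_
  rw [← hin (hbp k) hv]
  rfl

/-- On a finite measure space, the weak limit is bounded as well, and density of the simple functions passes from square integrable to
integrable test functions. -/
theorem exists_weak_limit_of_isFiniteMeasure {α : Type*} [MeasurableSpace α] {μ : Measure α}
    [IsFiniteMeasure μ] {b : ℕ → α → ℝ} {M : ℝ≥0} (hb : ∀ k, AEStronglyMeasurable (b k) μ)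
    (hM : ∀ k x, |b k x| ≤ M) :
    ∃ c : α → ℝ, AEStronglyMeasurable c μ ∧ (∀ᵐ x ∂μ, |c x| ≤ M) ∧
      ∀ v : α → ℝ, Integrable v μ →
      Tendsto (fun k => ∫ x, b k x * v x ∂μ) (hyperfilter ℕ : Filter ℕ)
        (𝓝 (∫ x, c x * v x ∂μ)) := by
  obtain ⟨c, hc, hlim⟩ := exists_weak_limit_L2 hb hM
  have hcint : Integrable c μ := hc.integrable one_le_two
  have hbint : ∀ k, Integrable (b k) μ := fun k =>
    Integrable.of_bound (hb k) M (Eventually.of_forall fun x => hM k x)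
  have hset : ∀ s, MeasurableSet s → Tendsto (fun k => ∫ x in s, b k x ∂μ)
      (hyperfilter ℕ : Filter ℕ) (𝓝 (∫ x in s, c x ∂μ)) := by
    intro s hs
    have h := hlim (s.indicator fun _ => 1) ((memLp_const (1 : ℝ)).indicator hs)
    have e : ∀ u : α → ℝ, ∫ x, u x * s.indicator (fun _ => (1 : ℝ)) x ∂μ = ∫ x in s, u x ∂μ := by
      intro u
      rw [← integral_indicator hs]
      refine integral_congr_ae (Eventually.of_forall fun x => ?_)
      by_cases hx : x ∈ s <;> simp [hx]
    simpa only [e] using h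
  -- The bound on `c` is read off from its integrals over measurable sets.
  have hle : ∀ᵐ x ∂μ, |c x| ≤ M := by
    have h1 : c ≤ᵐ[μ] fun _ => (M : ℝ) :=
      ae_le_of_forall_setIntegral_le hcint (integrable_const _) fun s hs _ =>
        le_of_tendsto (hset s hs) (Eventually.of_forall fun k =>
          setIntegral_mono (hbint k).integrableOn (integrable_const _).integrableOn
            fun x => (abs_le.1 (hM k x)).2)
    have h2 : (fun _ => -(M : ℝ)) ≤ᵐ[μ] c :=
      ae_le_of_forall_setIntegral_le (integrable_const _) hcint fun s hs _ =>
        ge_of_tendsto (hset s hs) (Eventually.of_forall fun k =>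
          setIntegral_mono (integrable_const _).integrableOn (hbint k).integrableOn
            fun x => (abs_le.1 (hM k x)).1)
    filter_upwards [h1, h2] with x hx1 hx2 using abs_le.2 ⟨hx2, hx1⟩
  refine ⟨c, hc.aestronglyMeasurable, hle, fun v hv => ?_⟩
  have hbd : ∀ {u w : α → ℝ}, AEStronglyMeasurable u μ → (∀ᵐ x ∂μ, |u x| ≤ M) →
      Integrable w μ → Integrable (fun x => u x * w x) μ := fun hu hu' hw =>
    hw.bdd_mul hu hu'
  have hest : ∀ {u w : α → ℝ}, (∀ᵐ x ∂μ, |u x| ≤ M) →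
      Integrable w μ → |∫ x, u x * w x ∂μ| ≤ M * ∫ x, |w x| ∂μ := by
    intro u w hu' hw
    rw [← integral_const_mul]
    refine norm_integral_le_of_norm_le (f := fun x => u x * w x) (hw.abs.const_mul _) ?_
    filter_upwards [hu'] with x hx
    rw [norm_mul]
    exact mul_le_mul_of_nonneg_right hx (norm_nonneg _)
  refine Metric.tendsto_nhds.2 fun ε hε => ?_
  -- An `L¹` error `η` in the test function costs at most `M * η ≤ ε / 4` on either side.
  set η : ℝ := ε / (4 * (M + 1))
  have hη : 0 < η := by positivity
  obtain ⟨w, hw, hw1⟩ := (memLp_one_iff_integrable.2 hv).exists_simpleFunc_eLpNorm_sub_lt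
    ENNReal.one_ne_top (ε := ENNReal.ofReal η) (by simpa using hη)
  have hwi : Integrable w μ := memLp_one_iff_integrable.1 hw1
  have hvw : ∫ x, |v x - w x| ∂μ < η := by
    have := (hv.sub hwi)
    rw [eLpNorm_one_eq_lintegral_enorm] at hw
    have h2 := integral_norm_eq_lintegral_enorm this.aestronglyMeasurable
    change ∫ x, ‖(v - w) x‖ ∂μ < η
    rw [h2]
    exact (ENNReal.toReal_lt_of_lt_ofReal hw)
  have hMη : M * η ≤ ε / 4 := by
    have : (M + 1 : ℝ) * η = ε / 4 := by
      simp only [η]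
      field_simp
    nlinarith
  filter_upwards [Metric.tendsto_nhds.1 (hlim w (w.memLp_of_isFiniteMeasure 2 μ)) (ε / 2) (half_pos hε)]
    with k hk
  have hdec : ∀ {u : α → ℝ}, AEStronglyMeasurable u μ → (∀ᵐ x ∂μ, |u x| ≤ M) →
      ∫ x, u x * v x ∂μ = ∫ x, u x * (v x - w x) ∂μ + ∫ x, u x * w x ∂μ := by
    intro u hu hu'
    have h := integral_add (hbd hu hu' (hv.sub hwi)) (hbd hu hu' hwi)
    simp only [Pi.sub_apply] at h
    rw [← h]
    refine integral_congr_ae (Eventually.of_forall fun x => ?_)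
    simp only
    ring
  have hbk : ∀ᵐ x ∂μ, |b k x| ≤ M := Eventually.of_forall (hM k)
  have h1 := (hest hbk (hv.sub hwi)).trans
    (mul_le_mul_of_nonneg_left hvw.le M.2)
  have h2 := (hest hle (hv.sub hwi)).trans
    (mul_le_mul_of_nonneg_left hvw.le M.2)
  rw [hdec (hb k) hbk, hdec hc.aestronglyMeasurable hle]
  rw [Real.dist_eq] at hk ⊢
  simp only [Pi.sub_apply] at h1 h2
  rw [abs_lt] at hk ⊢
  rw [abs_le] at h1 h2
  constructor <;> linarith [h1.1, h1.2, h2.1, h2.2, hk.1, hk.2]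

/-- A bounded sequence of functions has a weak-* limit in `L^∞` along an ultrafilter, with the same
bound. The reduction to a finite measure replaces `μ` by an equivalent finite measure and absorbs
the density into the test function. -/
theorem exists_weak_limit {α : Type*} [MeasurableSpace α] {μ : Measure α}
    [SigmaFinite μ] {b : ℕ → α → ℝ} {M : ℝ≥0} (hb : ∀ k, AEStronglyMeasurable (b k) μ)
    (hM : ∀ k x, |b k x| ≤ M) :
    ∃ c : α → ℝ, AEStronglyMeasurable c μ ∧ (∀ᵐ x ∂μ, |c x| ≤ M) ∧
      ∀ v : α → ℝ, Integrable v μ →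
      Tendsto (fun k => ∫ x, b k x * v x ∂μ) (hyperfilter ℕ : Filter ℕ)
        (𝓝 (∫ x, c x * v x ∂μ)) := by
  have h1 : μ ≪ μ.toFinite := absolutelyContinuous_toFinite μ
  have h2 : μ.toFinite ≪ μ := toFinite_absolutelyContinuous μ
  obtain ⟨c, hc, hle, hlim⟩ := exists_weak_limit_of_isFiniteMeasure
    (fun k => (hb k).mono_ac h2) hM
  refine ⟨c, hc.mono_ac h1, h1.ae_le hle, fun v hv => ?_⟩
  have e : ∀ u : α → ℝ, ∫ x, u x * ((μ.rnDeriv μ.toFinite x).toReal * v x) ∂μ.toFinite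
      = ∫ x, u x * v x ∂μ := by
    intro u
    rw [← integral_rnDeriv_smul h1]
    refine integral_congr_ae (Eventually.of_forall fun x => ?_)
    simp only [smul_eq_mul]
    ring
  have h := hlim (fun x => (μ.rnDeriv μ.toFinite x).toReal * v x)
    ((integrable_rnDeriv_smul_iff h1).2 hv)
  simpa only [e] using h

/-! ### The chain rule for smooth outer functions -/

theorem norm_le_of_coord_le {x : Euc n} {C : ℝ} (h : ∀ i, |x i| ≤ C) : ‖x‖ ≤ n * C := by
  rw [← (EuclideanSpace.basisFun (Fin n) ℝ).sum_repr x]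
  refine (norm_sum_le _ _).trans ((Finset.sum_le_sum fun i _ => ?_).trans_eq
    (by simp : ∑ _i : Fin n, C = n * C))
  rw [norm_smul]
  simpa using h i

/-- Mollification is symmetric with respect to the `L²` pairing. -/
theorem integral_mollify_mul (ρ : ContDiffBump (0 : Euc n)) {w θ : Euc n → ℝ}
    (hw : Integrable w volume) (hθ : Continuous θ) {C : ℝ} (hC : ∀ x, |θ x| ≤ C) :
    ∫ x, mollify ρ w x * θ x = ∫ z, w z * mollify ρ θ z := by
  have hρ : Integrable (ρ.normed volume) (volume : Measure (Euc n)) :=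
    ρ.continuous_normed.integrable_of_hasCompactSupport ρ.hasCompactSupport_normed
  have hint : Integrable (Function.uncurry fun x z => ρ.normed volume (x - z) * w z * θ x)
      ((volume : Measure (Euc n)).prod volume) := by
    have h := hw.convolution_integrand (lsmul ℝ ℝ) hρ
    have h2 := h.mul_bdd (g := fun p : Euc n × Euc n => θ p.1) (c := C)
      (hθ.comp continuous_fst).aestronglyMeasurable (Eventually.of_forall fun p => hC p.1)
    refine h2.congr (Eventually.of_forall fun p => ?_)
    simp only [Function.uncurry, lsmul_apply, smul_eq_mul]
    ring
  calc ∫ x, mollify ρ w x * θ x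
      = ∫ x, ∫ z, ρ.normed volume (x - z) * w z * θ x := by
        simp_rw [mollify_apply, integral_mul_const]
    _ = ∫ z, ∫ x, ρ.normed volume (x - z) * w z * θ x := integral_integral_swap hint
    _ = ∫ z, w z * mollify ρ θ z := by
        refine integral_congr_ae (Eventually.of_forall fun z => ?_)
        simp only
        rw [mollify_apply, ← integral_const_mul]
        refine integral_congr_ae (Eventually.of_forall fun x => ?_)
        simp only
        rw [← neg_sub z x, ρ.normed_neg]
        ring

theorem IsTest.eq_zero {U : Set (Euc n)} {ψ : Euc n → ℝ} (h : IsTest U ψ) {x : Euc n}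
    (hx : x ∉ U) : ψ x = 0 :=
  image_eq_zero_of_notMem_tsupport fun hx' => hx (h.support hx')

theorem fderiv_eq_zero_of_notMem_tsupport {ψ : Euc n → ℝ} {x : Euc n} (hx : x ∉ tsupport ψ) :
    fderiv ℝ ψ x = 0 :=
  image_eq_zero_of_notMem_tsupport fun h => hx (tsupport_fderiv_subset ℝ h)

theorem IsTest.fderiv_eq_zero {U : Set (Euc n)} {ψ : Euc n → ℝ} (h : IsTest U ψ) {x : Euc n}
    (hx : x ∉ U) : fderiv ℝ ψ x = 0 :=
  fderiv_eq_zero_of_notMem_tsupport fun hx' => hx (h.support hx')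

theorem IsTest.continuous_fderiv_apply {U : Set (Euc n)} {ψ : Euc n → ℝ} (h : IsTest U ψ)
    (v : Euc n) : Continuous fun x => fderiv ℝ ψ x v :=
  (h.smooth.continuous_fderiv (by simp)).clm_apply continuous_const

theorem IsTest.hasCompactSupport_fderiv_apply {U : Set (Euc n)} {ψ : Euc n → ℝ} (h : IsTest U ψ)
    (v : Euc n) : HasCompactSupport fun x => fderiv ℝ ψ x v :=
  h.compact.fderiv_apply ℝ v

theorem IsTest.integral_mul_fderiv {U : Set (Euc n)} {ψ : Euc n → ℝ} (h : IsTest U ψ)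
    {H : Euc n → ℝ} (hH : ContDiff ℝ 1 H) (v : Euc n) :
    ∫ x, H x * fderiv ℝ ψ x v = -∫ x, fderiv ℝ H x v * ψ x := by
  refine integral_mul_fderiv_eq_neg_fderiv_mul_of_integrable ?_ ?_ ?_
    (fun x _ => hH.differentiable one_ne_zero x) (fun x _ => h.smooth.differentiable (by simp) x)
  · exact (((hH.continuous_fderiv one_ne_zero).clm_apply continuous_const).mul
      h.smooth.continuous).integrable_of_hasCompactSupport h.compact.mul_left
  · exact (hH.continuous.mul
      (h.continuous_fderiv_apply v)).integrable_of_hasCompactSupport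
        (h.hasCompactSupport_fderiv_apply v).mul_left
  · exact (hH.continuous.mul h.smooth.continuous).integrable_of_hasCompactSupport h.compact.mul_left

/-- A continuous weakly differentiable mapping is approximated near a compact set by smooth
mappings, whose derivatives are mollifications of the weak derivatives. -/
theorem exists_smooth_approx {U : Set (Euc n)} (hU : IsOpen U) {φ : Euc n → Euc n}
    (hφ : ContinuousOn φ U) {D : Fin n → Euc n → Euc n}
    (hD : ∀ j, HasWeakGradient U (fun x => φ x j) (D j)) {K : Set (Euc n)} (hK : IsCompact K)
    (hKU : K ⊆ U) (i : Fin n) :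
    ∃ (Φ : ℕ → Euc n → Euc n) (w : Fin n → Euc n → ℝ) (R : ℝ),
      (∀ k, ContDiff ℝ 1 (Φ k)) ∧ (∀ k x, ‖Φ k x‖ ≤ R) ∧
      (∀ z ∈ K, Tendsto (Function.uncurry Φ) (atTop ×ˢ 𝓝 z) (𝓝 (φ z))) ∧
      (∀ j, Integrable (w j) volume) ∧ (∀ j, ∀ x ∈ K, w j x = D j x i) ∧
      ∀ᶠ k in atTop, ∀ x ∈ K, ∀ j,
        fderiv ℝ (Φ k) x (EuclideanSpace.single i 1) j = mollify (shrinkingBump n k) (w j) x := by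
  obtain ⟨δ, hδ, hδU⟩ := hK.exists_cthickening_subset_open hU hKU
  -- Restricting everything to a neighbourhood `K'` of `K` makes the data globally integrable
  -- and leaves the mollifications unchanged on `K`, once the radius is below `δ`.
  set K' := cthickening δ K
  have hK' : IsCompact K' := hK.cthickening
  have hKK' : K ⊆ K' := self_subset_cthickening K
  have hmeas : MeasurableSet K' := hK'.measurableSet
  obtain ⟨C, hC⟩ := hK'.exists_bound_of_continuousOn (hφ.mono hδU)
  set F : Fin n → Euc n → ℝ := fun j => K'.indicator fun x => φ x j
  have hF : ∀ j, Integrable (F j) volume := fun j =>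
    (((EuclideanSpace.proj (𝕜 := ℝ) j).continuous.comp_continuousOn
      (hφ.mono hδU)).integrableOn_compact hK').integrable_indicator hmeas
  have hFC : ∀ j x, |F j x| ≤ |C| := by
    intro j x
    by_cases hx : x ∈ K'
    · simp only [F, indicator_of_mem hx]
      exact (abs_coord_le_norm _ _).trans ((hC x hx).trans (le_abs_self C))
    · simp [F, indicator_of_notMem hx]
  set w : Fin n → Euc n → ℝ := fun j => K'.indicator fun x => D j x i
  have hw : ∀ j, Integrable (w j) volume := fun j =>
    ((locallyIntegrableOn_coord (hD j).locallyIntegrable i).integrableOn_compact_subset hδU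
      hK').integrable_indicator hmeas
  set Φ : ℕ → Euc n → Euc n := fun k x =>
    WithLp.toLp 2 fun j => mollify (shrinkingBump n k) (F j) x
  have hΦ : ∀ k, ContDiff ℝ 1 (Φ k) := fun k =>
    contDiff_euclidean.2 fun j => (contDiff_mollify _ (hF j).locallyIntegrable).of_le (by simp)
  refine ⟨Φ, w, n * |C|, hΦ, fun k x => norm_le_of_coord_le fun j => abs_mollify_le _ (hFC j) x,
    fun z hz => ?_, hw, fun j x hx => indicator_of_mem (hKK' hx) _, ?_⟩
  · have hco : ∀ j, Tendsto (fun p : ℕ × Euc n => mollify (shrinkingBump n p.1) (F j) p.2)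
        (atTop ×ˢ 𝓝 z) (𝓝 (φ z j)) := by
      intro j
      refine tendsto_mollify (F := fun _ => F j) tendsto_fst
        (Eventually.of_forall fun _ => (hF j).aestronglyMeasurable) ?_ tendsto_snd
      have hc : Tendsto (F j) (𝓝 z) (𝓝 (φ z j)) := by
        have h1 : Tendsto (fun x => φ x j) (𝓝 z) (𝓝 (φ z j)) :=
          ((EuclideanSpace.proj (𝕜 := ℝ) j).continuous.tendsto _).comp
            (hφ.continuousAt (hU.mem_nhds (hKU hz)))
        refine h1.congr' ?_
        filter_upwards [isOpen_thickening.mem_nhds (self_subset_thickening hδ K hz)] with x hx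
        exact (indicator_of_mem (thickening_subset_cthickening δ K hx) fun y => φ y j).symm
      exact hc.comp tendsto_snd
    exact ((PiLp.continuous_toLp 2 _).tendsto _).comp (tendsto_pi_nhds.2 hco)
  · filter_upwards [eventually_rOut_shrinkingBump_lt (n := n) hδ] with k hk x hx j
    have hsub : closedBall x (shrinkingBump n k).rOut ⊆ K' :=
      (closedBall_subset_closedBall hk.le).trans (closedBall_subset_cthickening hx δ)
    have h1 : HasFDerivAt (fun y => Φ k y j)
        ((EuclideanSpace.proj (𝕜 := ℝ) j).comp (fderiv ℝ (Φ k) x)) x :=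
      (EuclideanSpace.proj (𝕜 := ℝ) j).hasFDerivAt.comp x
        ((hΦ k).differentiable one_ne_zero x).hasFDerivAt
    have h2 := fderiv_mollify_apply (hD j) (shrinkingBump n k) (hsub.trans hδU)
      (hF j).locallyIntegrable
      (Eventually.of_forall fun z hz => indicator_of_mem (hsub hz) fun x => φ x j) i
      (W := w j) (Eventually.of_forall fun z hz => indicator_of_mem (hsub hz) fun x => D j x i)
    rw [← h2]
    have h3 : fderiv ℝ (mollify (shrinkingBump n k) (F j)) x = _ := h1.fderiv
    rw [h3]
    rfl

/-- The chain rule for a `C¹` function of a continuous weakly differentiable mapping, in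
integrated form. The mollifier is moved from the weak derivatives of the mapping, which need not
converge pointwise, to the remaining continuous factor. -/
theorem integral_comp_mul_fderiv {U : Set (Euc n)} (hU : IsOpen U) {φ : Euc n → Euc n}
    (hφ : ContinuousOn φ U) {D : Fin n → Euc n → Euc n}
    (hD : ∀ j, HasWeakGradient U (fun x => φ x j) (D j)) {G : Euc n → ℝ} (hG : ContDiff ℝ 1 G)
    {ψ : Euc n → ℝ} (hψ : IsTest U ψ) (i : Fin n) :
    ∫ x in U, G (φ x) * fderiv ℝ ψ x (EuclideanSpace.single i 1) =
      -∑ j, ∫ x in U, fderiv ℝ G (φ x) (EuclideanSpace.single j 1) * (D j x i * ψ x) := by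
  obtain ⟨Φ, w, R, hΦ, hΦR, hΦlim, hw, hwD, hder⟩ :=
    exists_smooth_approx hU hφ hD hψ.compact hψ.support i
  have hcG : ∀ j : Fin n, Continuous fun y => fderiv ℝ G y (EuclideanSpace.single j (1 : ℝ)) :=
    fun j => (hG.continuous_fderiv one_ne_zero).clm_apply continuous_const
  -- After the integration by parts `∂ᵢ (Φ k)ⱼ` is integrated against `θ j k`, which is continuous.
  set θ : Fin n → ℕ → Euc n → ℝ := fun j k x =>
    fderiv ℝ G (Φ k x) (EuclideanSpace.single j 1) * ψ x
  have hθ : ∀ j k, Continuous (θ j k) := fun j k =>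
    ((hcG j).comp (hΦ k).continuous).mul hψ.smooth.continuous
  have hθC : ∀ j, ∃ C, ∀ k x, |θ j k x| ≤ C := by
    intro j
    obtain ⟨C₁, hC₁⟩ := (isCompact_closedBall (0 : Euc n) R).exists_bound_of_continuousOn
      (hcG j).continuousOn
    obtain ⟨C₂, hC₂⟩ := hψ.smooth.continuous.bounded_above_of_compact_support hψ.compact
    refine ⟨C₁ * C₂, fun k x => ?_⟩
    have h1 := hC₁ (Φ k x) (mem_closedBall_zero_iff.2 (hΦR k x))
    simp only [θ, abs_mul]
    exact mul_le_mul h1 (hC₂ x) (abs_nonneg _) ((norm_nonneg _).trans h1)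
  choose C hC using hθC
  have hθlim : ∀ j z, Tendsto (fun k => mollify (shrinkingBump n k) (θ j k) z) atTop
      (𝓝 (fderiv ℝ G (φ z) (EuclideanSpace.single j 1) * ψ z)) := by
    intro j z
    refine tendsto_mollify tendsto_id (Eventually.of_forall fun k => (hθ j k).aestronglyMeasurable)
      ?_ tendsto_const_nhds
    by_cases hz : z ∈ tsupport ψ
    · exact (((hcG j).tendsto _).comp (hΦlim z hz)).mul
        ((hψ.smooth.continuous.tendsto z).comp tendsto_snd)
    · rw [image_eq_zero_of_notMem_tsupport hz, mul_zero]
      refine tendsto_const_nhds.congr' ?_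
      have := (isClosed_tsupport ψ).isOpen_compl.mem_nhds hz
      filter_upwards [tendsto_snd.eventually this] with p hp
      simp [Function.uncurry, θ, image_eq_zero_of_notMem_tsupport hp]
  have hleft : Tendsto
      (fun k => ∫ x, G (Φ k x) * fderiv ℝ ψ x (EuclideanSpace.single i 1)) atTop
      (𝓝 (∫ x, G (φ x) * fderiv ℝ ψ x (EuclideanSpace.single i 1))) := by
    obtain ⟨C₁, hC₁⟩ := (isCompact_closedBall (0 : Euc n) R).exists_bound_of_continuousOn
      hG.continuous.continuousOn
    refine tendsto_integral_of_dominated_convergence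
      (fun x => C₁ * |fderiv ℝ ψ x (EuclideanSpace.single i 1)|) (fun k => ?_) ?_ (fun k => ?_) ?_
    · exact ((hG.continuous.comp (hΦ k).continuous).mul
        (hψ.continuous_fderiv_apply _)).aestronglyMeasurable
    · exact ((hψ.continuous_fderiv_apply _).integrable_of_hasCompactSupport
        (hψ.hasCompactSupport_fderiv_apply _)).abs.const_mul C₁
    · refine Eventually.of_forall fun x => ?_
      rw [norm_mul]
      exact mul_le_mul_of_nonneg_right (hC₁ _ (mem_closedBall_zero_iff.2 (hΦR k x)))
        (norm_nonneg _)
    · refine Eventually.of_forall fun x => ?_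
      by_cases hx : x ∈ tsupport ψ
      · exact ((hG.continuous.tendsto _).comp ((hΦlim x hx).comp
          (tendsto_id.prodMk tendsto_const_nhds))).mul tendsto_const_nhds
      · simp [fderiv_eq_zero_of_notMem_tsupport hx]
  have hright : ∀ j, Tendsto (fun k => ∫ z, w j z * mollify (shrinkingBump n k) (θ j k) z) atTop
      (𝓝 (∫ z, w j z * (fderiv ℝ G (φ z) (EuclideanSpace.single j 1) * ψ z))) := by
    intro j
    refine tendsto_integral_of_dominated_convergence (fun z => |w j z| * C j) (fun k => ?_)
      ((hw j).abs.mul_const _) (fun k => ?_)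
      (Eventually.of_forall fun z => tendsto_const_nhds.mul (hθlim j z))
    · exact (hw j).aestronglyMeasurable.mul
        (contDiff_mollify _ (hθ j k).locallyIntegrable).continuous.aestronglyMeasurable
    · refine Eventually.of_forall fun z => ?_
      rw [norm_mul]
      exact mul_le_mul_of_nonneg_left (abs_mollify_le _ (hC j k) z) (norm_nonneg _)
  have hstep : ∀ᶠ k in atTop, ∫ x, G (Φ k x) * fderiv ℝ ψ x (EuclideanSpace.single i 1) =
      -∑ j, ∫ z, w j z * mollify (shrinkingBump n k) (θ j k) z := by
    filter_upwards [hder] with k hk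
    have h1 := hψ.integral_mul_fderiv (hG.comp (hΦ k)) (EuclideanSpace.single i 1)
    simp only [Function.comp_apply] at h1
    rw [h1, neg_inj]
    have hmw : ∀ j, Integrable (fun x => mollify (shrinkingBump n k) (w j) x * θ j k x) volume :=
      fun j => ((contDiff_mollify _ (hw j).locallyIntegrable).continuous.mul
        (hθ j k)).integrable_of_hasCompactSupport (hψ.compact.mul_left).mul_left
    simp_rw [← fun j => integral_mollify_mul (shrinkingBump n k) (hw j) (hθ j k) (hC j k)]
    rw [← integral_finsetSum _ fun j _ => hmw j]
    refine integral_congr_ae (Eventually.of_forall fun x => ?_)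
    simp only
    by_cases hx : x ∈ tsupport ψ
    · have h2 : fderiv ℝ (G ∘ Φ k) x = (fderiv ℝ G (Φ k x)).comp (fderiv ℝ (Φ k) x) :=
        fderiv_comp x (hG.differentiable one_ne_zero _) ((hΦ k).differentiable one_ne_zero x)
      rw [h2, comp_apply, apply_eq_sum_single, Finset.sum_mul]
      refine Finset.sum_congr rfl fun j _ => ?_
      rw [hk x hx j]
      simp only [θ]
      ring
    · simp [θ, image_eq_zero_of_notMem_tsupport hx]
  have hlim := tendsto_nhds_unique (hleft.congr' hstep)
    (tendsto_finsetSum Finset.univ fun j _ => hright j).neg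
  rw [setIntegral_eq_integral_of_forall_compl_eq_zero fun x hx => by
    simp [hψ.fderiv_eq_zero hx], hlim, neg_inj]
  refine Finset.sum_congr rfl fun j _ => ?_
  rw [setIntegral_eq_integral_of_forall_compl_eq_zero fun x hx => by
    simp [hψ.eq_zero hx]]
  refine integral_congr_ae (Eventually.of_forall fun x => ?_)
  simp only
  by_cases hx : x ∈ tsupport ψ
  · rw [hwD j x hx]
    ring
  · simp [image_eq_zero_of_notMem_tsupport hx]

/-! ### Composition with a function of bounded weak gradient -/

theorem hasWeakGradient_coord (U : Set (Euc n)) (j : Fin n) :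
    HasWeakGradient U (fun y => y j) (fun _ => EuclideanSpace.single j 1) where
  locallyIntegrable := locallyIntegrableOn_const _
  integral_eq ψ hψ i := by
    have hH : ContDiff ℝ 1 fun y : Euc n => y j := (EuclideanSpace.proj (𝕜 := ℝ) j).contDiff
    have hd : ∀ x : Euc n, fderiv ℝ (fun y : Euc n => y j) x = EuclideanSpace.proj (𝕜 := ℝ) j :=
      fun x => (EuclideanSpace.proj (𝕜 := ℝ) j).fderiv
    have h := hψ.integral_mul_fderiv hH (EuclideanSpace.single i 1)
    rw [setIntegral_eq_integral_of_forall_compl_eq_zero fun x hx => by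
        simp [hψ.fderiv_eq_zero hx],
      setIntegral_eq_integral_of_forall_compl_eq_zero fun x hx => by
        simp [hψ.eq_zero hx], h]
    simp [hd, eq_comm]

theorem seminormL1_eq {p : ℝ≥0∞} {U : Set (Euc n)} (hU : IsOpen U) {f : Euc n → ℝ}
    {g : Euc n → Euc n} (hg : HasWeakGradient U f g) :
    seminormL1 p U f = eLpNorm g p (volume.restrict U) :=
  eLpNorm_congr_ae ((hasWeakGradient_weakGradient ⟨g, hg⟩).ae_eq hU hg)

theorem memL1_top_coord {U : Set (Euc n)} (hU : IsOpen U) (j : Fin n) :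
    MemL1 ⊤ U fun y => y j := by
  refine ⟨⟨?_, _, hasWeakGradient_coord U j⟩, ?_⟩
  · exact (EuclideanSpace.proj (𝕜 := ℝ) j).continuous.locallyIntegrable.locallyIntegrableOn U
  · rw [seminormL1_eq hU (hasWeakGradient_coord U j)]
    exact (memLp_top_const _).2

/-- The weak gradient of the composition of a function with bounded weak gradient and a continuous
weakly differentiable mapping. The coefficients `a j` take the place of `(∂ⱼ f) ∘ φ`, which has no
meaning as `∂ⱼ f` is only defined almost everywhere; they are weak limits of mollifications
of `∂ⱼ f` composed with `φ`. -/
theorem exists_hasWeakGradient_refined_comp {U V : Set (Euc n)} (hU : IsOpen U) (hV : IsOpen V)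
    {φ : Euc n → Euc n} (hφ : ContinuousOn φ U) (hmaps : MapsTo φ U V) {D : Fin n → Euc n → Euc n}
    (hD : ∀ j, HasWeakGradient U (fun x => φ x j) (D j)) {f : Euc n → ℝ} {g : Euc n → Euc n}
    (hf : LocallyIntegrableOn f V volume) (hg : HasWeakGradient V f g) {M : ℝ≥0}
    (hM : ∀ᵐ z, z ∈ V → ‖g z‖ ≤ M) :
    ∃ a : Fin n → Euc n → ℝ, (∀ j, AEStronglyMeasurable (a j) (volume.restrict U)) ∧
      (∀ j, ∀ᵐ x ∂volume.restrict U, |a j x| ≤ M) ∧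
      HasWeakGradient U (refined f ∘ φ) fun x => ∑ j, a j x • D j x := by
  obtain ⟨-, hcont, hae⟩ := refined_of_bounded_weakGradient hV hf hg hM
  choose W hWint hWM hWg using exists_bounded_coord hV hg.locallyIntegrable hM
  have hφm : AEStronglyMeasurable φ (volume.restrict U) :=
    hφ.aestronglyMeasurable hU.measurableSet
  choose a ham haM halim using fun j => exists_weak_limit (μ := volume.restrict U)
    (b := fun k x => mollify (shrinkingBump n k) (W j) (φ x))
    (fun k => (contDiff_mollify _ (hWint j)).continuous.comp_aestronglyMeasurable hφm)
    (fun k x => abs_mollify_le _ (hWM j) (φ x))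
  refine ⟨a, ham, haM, ?_, fun ψ hψ i => ?_⟩
  · refine (locallyIntegrableOn_iff hU.isLocallyClosed).2 fun k hkU hk => ?_
    refine integrable_finsetSum _ fun j _ => ?_
    exact ((hD j).locallyIntegrable.integrableOn_compact_subset hkU hk).bdd_smul
      (M : ℝ) ((ham j).mono_measure (Measure.restrict_mono_set _ hkU))
      (ae_restrict_of_ae_restrict_of_subset hkU (haM j))
  have hv : ∀ j, Integrable (fun x => D j x i * ψ x) (volume.restrict U) := by
    intro j
    have h1 : IntegrableOn (fun x => D j x i * ψ x) (tsupport ψ) volume :=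
      ((locallyIntegrableOn_coord (hD j).locallyIntegrable i).integrableOn_compact_subset
        hψ.support hψ.compact).mul_continuousOn hψ.smooth.continuous.continuousOn hψ.compact
    refine ((integrableOn_iff_integrable_of_support_subset fun x hx => ?_).1 h1).restrict
    exact subset_tsupport ψ (right_ne_zero_of_mul hx)
  -- A mollification of the refined function, cut off outside a neighbourhood of `φ (supp ψ)`.
  have hL : IsCompact (φ '' tsupport ψ) := hψ.compact.image_of_continuousOn (hφ.mono hψ.support)
  have hLV : φ '' tsupport ψ ⊆ V := (image_mono hψ.support).trans hmaps.image_subset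
  obtain ⟨δ, hδ, hδV⟩ := hL.exists_cthickening_subset_open hV hLV
  set L' := cthickening δ (φ '' tsupport ψ)
  have hL' : IsCompact L' := hL.cthickening
  obtain ⟨C, hC⟩ := hL'.exists_bound_of_continuousOn (hcont.mono hδV)
  set F : Euc n → ℝ := L'.indicator (refined f)
  have hF : Integrable F volume :=
    ((hcont.mono hδV).integrableOn_compact hL').integrable_indicator hL'.measurableSet
  have hFC : ∀ y, |F y| ≤ |C| := by
    intro y
    by_cases hy : y ∈ L'
    · simp only [F, indicator_of_mem hy]
      exact (hC y hy).trans (le_abs_self C)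
    · simp [F, indicator_of_notMem hy]
  have hFlim : ∀ x ∈ tsupport ψ, Tendsto (fun k => mollify (shrinkingBump n k) F (φ x)) atTop
      (𝓝 (refined f (φ x))) := by
    intro x hx
    refine tendsto_mollify (F := fun _ => F) tendsto_id
      (Eventually.of_forall fun _ => hF.aestronglyMeasurable) ?_ tendsto_const_nhds
    have hφx := mem_image_of_mem φ hx
    have hc : Tendsto F (𝓝 (φ x)) (𝓝 (refined f (φ x))) := by
      refine (hcont.continuousAt (hV.mem_nhds (hLV hφx))).tendsto.congr' ?_
      filter_upwards [isOpen_thickening.mem_nhds (self_subset_thickening hδ _ hφx)] with y hy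
      exact (indicator_of_mem (thickening_subset_cthickening δ _ hy) _).symm
    exact hc.comp tendsto_snd
  have hleft : Tendsto (fun k => ∫ x in U, mollify (shrinkingBump n k) F (φ x) *
      fderiv ℝ ψ x (EuclideanSpace.single i 1)) atTop
      (𝓝 (∫ x in U, refined f (φ x) * fderiv ℝ ψ x (EuclideanSpace.single i 1))) := by
    refine tendsto_integral_of_dominated_convergence
      (fun x => |C| * |fderiv ℝ ψ x (EuclideanSpace.single i 1)|) (fun k => ?_) ?_ (fun k => ?_) ?_
    · exact ((contDiff_mollify _ hF.locallyIntegrable).continuous.comp_aestronglyMeasurable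
        hφm).mul (hψ.continuous_fderiv_apply _).aestronglyMeasurable
    · exact (((hψ.continuous_fderiv_apply _).integrable_of_hasCompactSupport
        (hψ.hasCompactSupport_fderiv_apply _)).abs.const_mul _).restrict
    · refine Eventually.of_forall fun x => ?_
      rw [norm_mul]
      exact mul_le_mul_of_nonneg_right (abs_mollify_le _ hFC _) (norm_nonneg _)
    · refine Eventually.of_forall fun x => ?_
      by_cases hx : x ∈ tsupport ψ
      · exact (hFlim x hx).mul tendsto_const_nhds
      · simp [fderiv_eq_zero_of_notMem_tsupport hx]
  have hstep : ∀ᶠ k in atTop, ∫ x in U, mollify (shrinkingBump n k) F (φ x) *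
      fderiv ℝ ψ x (EuclideanSpace.single i 1) =
      -∑ j, ∫ x in U, mollify (shrinkingBump n k) (W j) (φ x) * (D j x i * ψ x) := by
    filter_upwards [eventually_rOut_shrinkingBump_lt (n := n) hδ] with k hk
    rw [integral_comp_mul_fderiv hU hφ hD
      ((contDiff_mollify (shrinkingBump n k) hF.locallyIntegrable).of_le (by simp)) hψ i, neg_inj]
    refine Finset.sum_congr rfl fun j _ => integral_congr_ae (Eventually.of_forall fun x => ?_)
    simp only
    by_cases hx : x ∈ tsupport ψ
    · have hsub : closedBall (φ x) (shrinkingBump n k).rOut ⊆ L' :=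
        (closedBall_subset_closedBall hk.le).trans
          (closedBall_subset_cthickening (mem_image_of_mem φ hx) δ)
      rw [fderiv_mollify_apply hg (shrinkingBump n k) (hsub.trans hδV) hF.locallyIntegrable
        (by
          filter_upwards [hae] with z hz hzb
          rw [← hz (hδV (hsub hzb))]
          exact indicator_of_mem (hsub hzb) _) j
        (by filter_upwards [hWg j] with z hz hzb using hz (hδV (hsub hzb)))]
    · simp [image_eq_zero_of_notMem_tsupport hx]
  have hlim := tendsto_nhds_unique
    ((hleft.congr' hstep).mono_left (Nat.hyperfilter_le_atTop))
    (tendsto_finsetSum Finset.univ fun j _ => halim j _ (hv j)).neg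
  simp only [Function.comp_apply]
  rw [hlim, neg_inj, ← integral_finsetSum _ fun j _ => (hv j).bdd_mul (ham j) (haM j)]
  refine integral_congr_ae (Eventually.of_forall fun x => ?_)
  simp [Finset.sum_mul, mul_assoc]

end SobolevComposition

open SobolevComposition in
theorem mainTheorem8 {n : ℕ}
    (Ω Ω' : Set (EuclideanSpace ℝ (Fin n)))
    (hΩ : SobolevComposition.IsDomainSet Ω) (hΩ' : SobolevComposition.IsDomainSet Ω')
    (φ : OpenPartialHomeomorph (EuclideanSpace ℝ (Fin n)) (EuclideanSpace ℝ (Fin n)))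
    (hsource : φ.source = Ω) (htarget : φ.target = Ω')
    (p : ENNReal) (hp : 1 ≤ p) :
    SobolevComposition.MapMemL1 p Ω φ ↔
      SobolevComposition.IsBoundedCompositionLInfty p Ω Ω' φ := by
  subst hsource htarget
  constructor
  · intro hmem
    have hD : ∀ j, HasWeakGradient φ.source (fun x => φ x j)
        (weakGradient φ.source fun x => φ x j) :=
      fun j => hasWeakGradient_weakGradient (hmem j).1.2
    have hK : ∑ j, seminormL1 p φ.source (fun x => φ x j) ≠ ⊤ :=
      ENNReal.sum_ne_top.2 fun j _ => (hmem j).2.ne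
    refine ⟨(∑ j, seminormL1 p φ.source fun x => φ x j).toNNReal, fun f hf => ?_⟩
    rw [ENNReal.coe_toNNReal hK]
    have hg := hasWeakGradient_weakGradient hf.1.2
    have hM : ∀ᵐ z, z ∈ φ.target →
        ‖weakGradient φ.target f z‖ ≤ (seminormL1 ⊤ φ.target f).toNNReal := by
      rw [← ae_restrict_iff' hΩ'.isOpen.measurableSet]
      filter_upwards [ae_le_eLpNormEssSup (f := weakGradient φ.target f)
        (μ := volume.restrict φ.target)] with z hz
      rw [← coe_nnnorm, NNReal.coe_le_coe, ← ENNReal.coe_le_coe, ENNReal.coe_toNNReal hf.2.ne]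
      rwa [seminormL1, eLpNorm_exponent_top]
    obtain ⟨hval, hcont, -⟩ := refined_of_bounded_weakGradient hΩ'.isOpen hf.1.1 hg hM
    obtain ⟨a, ham, haM, hgrad⟩ := exists_hasWeakGradient_refined_comp hΩ.isOpen hΩ'.isOpen
      φ.continuousOn φ.mapsTo hD hf.1.1 hg hM
    have hle : seminormL1 p φ.source (refined f ∘ φ) ≤
        (∑ j, seminormL1 p φ.source fun x => φ x j) * seminormL1 ⊤ φ.target f := by
      rw [seminormL1_eq hΩ.isOpen hgrad, Finset.sum_mul]
      have hsum : (fun x => ∑ j, a j x • weakGradient φ.source (fun x => φ x j) x) =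
          ∑ j, fun x => a j x • weakGradient φ.source (fun x => φ x j) x := by
        ext1 x
        simp
      rw [hsum]
      refine (eLpNorm_sum_le (fun j _ => (ham j).smul
        (hD j).locallyIntegrable.aestronglyMeasurable) hp).trans (Finset.sum_le_sum fun j _ => ?_)
      rw [mul_comm, ← ENNReal.coe_toNNReal hf.2.ne]
      refine eLpNorm_le_nnreal_smul_eLpNorm_of_ae_le_mul ?_ p
      filter_upwards [haM j] with x hx
      rw [Pi.smul_apply', nnnorm_smul]
      exact mul_le_mul_of_nonneg_right (NNReal.coe_le_coe.1 (by simpa using hx)) zero_le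
    refine ⟨fun x hx => ⟨_, hval _ (φ.mapsTo hx)⟩, ⟨⟨?_, _, hgrad⟩, ?_⟩, hle⟩
    · exact (hcont.comp φ.continuousOn φ.mapsTo).locallyIntegrableOn hΩ.isOpen.measurableSet
    · exact hle.trans_lt (ENNReal.mul_lt_top hK.lt_top hf.2)
  · rintro ⟨K, hK⟩ j
    have h := (hK _ (memL1_top_coord hΩ'.isOpen j)).2.1
    have hc : Continuous fun y : Euc n => y j := (EuclideanSpace.proj (𝕜 := ℝ) j).continuous
    rwa [refined_eq_self hc] at h
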